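/- Let $p,s\ge 1$ be integers, let $\theta>0$, $A_i,\alpha_i>0$, $a_i\ge 0$ ($1\le i\le p$) and $B_j,\beta_j>0$, $b_j\ge 0$ ($1\le j\le s$) be real numbers, and put $$V(x)=\theta^{-x}\,\frac{\prod_{i=1}^{p}\Gamma(A_ix+a_i)^{\alpha_i}}{\prod_{j=1}^{s}\Gamma(B_jx+b_j)^{\beta_j}},\qquad x>0.$$ A function $f$ on $(0,\infty)$ is completely monotonic if it is infinitely differentiable and $(-1)^nf^{(n)}(x)\ge 0$ for all $n\ge 0$ and $x>0$; a positive function $f$ on $(0,\infty)$ is logarithmically completely monotonic if $\log f$ is differentiable and $-(\log f)'$ is completely monotonic. If $V$ is logarithmically completely monotonic, then $$\sum_{i=1}^{p}\alpha_iA_i=\sum_{j=1}^{s}\beta_jB_j,\qquad \rho:=\prod_{i=1}^{p}A_i^{\alpha_iA_i}\prod_{j=1}^{s}B_j^{-\beta_jB_j}\le\theta,$$ and moreover: (a) $\displaystyle\sum_{j=1}^{s}\beta_j\Bigl(b_j-\frac12\Bigr)-\sum_{i=1}^{p}\alpha_i\Bigl(a_i-\frac12\Bigr)\ge 0$; (b)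 $\displaystyle\min_{1\le i\le p}\frac{a_i}{A_i}\le\min_{1\le j\le s}\frac{b_j}{B_j}$, and in case of equality $\displaystyle\sum_{k\in I}\alpha_k\ge\sum_{m\in J}\beta_m$, where $I$ and $J$ are the sets of indices at which the minimum on the left, respectively on the right, is attained. -/

import Mathlib

open Set
open scoped ContDiff

noncomputable section

/-- Completely monotonic functions on `(0, ∞)`: smooth there, with
`(-1)^n f^(n)(x) ≥ 0` for all `n ≥ 0` and `x > 0`.
(At a point of the open half-line `iteratedDeriv` only sees `f` near that point.) -/
def IsCompletelyMonotonic (f : ℝ → ℝ) : Prop :=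
  ContDiffOn ℝ ∞ f (Ioi 0) ∧
    ∀ n : ℕ, ∀ x : ℝ, 0 < x → 0 ≤ (-1 : ℝ) ^ n * iteratedDeriv n f x

/-- Logarithmically completely monotonic functions on `(0, ∞)`: positive there, with
`log f` differentiable there and `-(log f)'` completely monotonic. -/
def IsLogCompletelyMonotonic (f : ℝ → ℝ) : Prop :=
  (∀ x : ℝ, 0 < x → 0 < f x) ∧
    DifferentiableOn ℝ (fun x => Real.log (f x)) (Ioi 0) ∧
    IsCompletelyMonotonic (fun x => -deriv (fun y => Real.log (f y)) x)

/-- `V(x) = θ^(-x) ∏ i, Γ(A i * x + a i)^(α i) / ∏ j, Γ(B j * x + b j)^(β j)`. -/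
def gammaRatio {p s : ℕ} (θ : ℝ) (A a α : Fin p → ℝ) (B b β : Fin s → ℝ) (x : ℝ) : ℝ :=
  θ ^ (-x) * ((∏ i, Real.Gamma (A i * x + a i) ^ α i) /
    ∏ j, Real.Gamma (B j * x + b j) ^ β j)

/-- `ρ = ∏ i, A i ^ (α i * A i) * ∏ j, B j ^ (-(β j * B j))`. -/
def gammaRatioRho {p s : ℕ} (A α : Fin p → ℝ) (B β : Fin s → ℝ) : ℝ :=
  (∏ i, A i ^ (α i * A i)) * ∏ j, B j ^ (-(β j * B j))

/-- The smallest of the quotients `c k / C k`. -/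
def minQuotient {n : ℕ} [NeZero n] (C c : Fin n → ℝ) : ℝ :=
  Finset.univ.inf' Finset.univ_nonempty (fun k => c k / C k)

/-- The set of indices at which the smallest quotient `c k / C k` is attained. -/
def minIndices {n : ℕ} [NeZero n] (C c : Fin n → ℝ) : Finset (Fin n) :=
  Finset.univ.filter (fun k => c k / C k = minQuotient C c)

end

/-! Everything is read off `f = -(log V)'`, a constant plus a weighted sum of digamma functions. At
infinity `f(x) = S log x + (log θ - log ρ) + c/x + o(1/x)`, where `S` is the difference of the two
sums in the balance condition and `c` is the quantity in (a). A nonnegative nonincreasing function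
forces `S = 0` and makes the other two coefficients nonnegative (`expansion_coeffs_of_antitoneOn`).

For (b), let `r` be the smaller of the two minimal quotients. Then `f` is holomorphic on `re z >
-r`, and its Taylor series at a point `c > 0` has coefficients of alternating sign, so `f ≥ 0` on
all of `(-r, ∞)`. Hence the residue at `-r`, the `α`-sum minus the `β`-sum over the indices with
quotient `r`, is nonnegative (`sum_le_sum_of_isLogCompletelyMonotonic`). -/

open Filter Topology

/-! ### Digamma on the half-line: bounds and asymptotics at infinity -/

/-- The digamma function of a real variable. -/
noncomputable def realDigamma : ℝ → ℝ := logDeriv Real.Gamma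

lemma hasDerivAt_log_Gamma {x : ℝ} (hx : 0 < x) :
    HasDerivAt (fun y => Real.log (Real.Gamma y)) (realDigamma x) x :=
  ((Real.differentiableOn_Gamma_Ioi x hx).differentiableAt
    (Ioi_mem_nhds hx)).hasDerivAt.log (Real.Gamma_pos_of_pos hx).ne'

lemma realDigamma_add_one {x : ℝ} (hx : 0 < x) : realDigamma (x + 1) = realDigamma x + x⁻¹ := by
  have h1 : HasDerivAt (fun y => Real.log (Real.Gamma (y + 1))) (realDigamma (x + 1)) x :=
    (hasDerivAt_log_Gamma (by linarith : 0 < x + 1)).comp_add_const x 1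
  have h2 : HasDerivAt (fun y => Real.log (Real.Gamma (y + 1))) (realDigamma x + x⁻¹) x := by
    refine ((hasDerivAt_log_Gamma hx).add (Real.hasDerivAt_log hx.ne')).congr_of_eventuallyEq ?_
    filter_upwards [Ioi_mem_nhds hx] with y hy
    have hy : 0 < y := hy
    rw [Pi.add_apply, Real.Gamma_add_one hy.ne',
      Real.log_mul hy.ne' (Real.Gamma_pos_of_pos hy).ne', add_comm]
  exact h1.unique h2

lemma log_Gamma_add_one {x : ℝ} (hx : 0 < x) :
    Real.log (Real.Gamma (x + 1)) = Real.log (Real.Gamma x) + Real.log x := by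
  rw [Real.Gamma_add_one hx.ne', Real.log_mul hx.ne' (Real.Gamma_pos_of_pos hx).ne', add_comm]

/-- `log Γ` is convex and its slope over `[x, x + 1]` is `log x`; this slope dominates the
derivative at the left end. The right end gives the next lemma. -/
lemma realDigamma_le_log {x : ℝ} (hx : 0 < x) : realDigamma x ≤ Real.log x := by
  have hx1 : 0 < x + 1 := by linarith
  have h := Real.convexOn_log_Gamma.deriv_le_slope (x := x) (y := x + 1) hx hx1 (by linarith)
    (hasDerivAt_log_Gamma hx).differentiableAt
  have h' : deriv (Real.log ∘ Real.Gamma) x = realDigamma x := (hasDerivAt_log_Gamma hx).deriv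
  rw [h', slope_def_field, Function.comp_apply, Function.comp_apply, log_Gamma_add_one hx] at h
  simpa using h

lemma log_le_realDigamma_add_inv {x : ℝ} (hx : 0 < x) : Real.log x ≤ realDigamma x + x⁻¹ := by
  have hx1 : 0 < x + 1 := by linarith
  have h := Real.convexOn_log_Gamma.slope_le_deriv (x := x) (y := x + 1) hx hx1 (by linarith)
    (hasDerivAt_log_Gamma hx1).differentiableAt
  have h' : deriv (Real.log ∘ Real.Gamma) (x + 1) = realDigamma (x + 1) :=
    (hasDerivAt_log_Gamma hx1).deriv
  rw [h', slope_def_field, Function.comp_apply, Function.comp_apply, log_Gamma_add_one hx,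
    realDigamma_add_one hx] at h
  simpa using h

/-- This is `t ≤ sinh t` at `t = log ((x + 1) / x)`. -/
lemma log_add_one_sub_log_le {x : ℝ} (hx : 0 < x) :
    Real.log (x + 1) - Real.log x ≤ (x⁻¹ + (x + 1)⁻¹) / 2 := by
  have hx1 : 0 < x + 1 := by linarith
  have hy : 0 < (x + 1) / x := div_pos hx1 hx
  rw [← Real.log_div hx1.ne' hx.ne']
  have h0 : 0 ≤ Real.log ((x + 1) / x) := Real.log_nonneg (by rw [le_div_iff₀ hx]; linarith)
  refine (Real.self_le_sinh_iff.2 h0).trans (le_of_eq ?_)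
  rw [Real.sinh_log hy]
  field_simp
  ring

lemma le_log_add_one_sub_log {x : ℝ} (hx : 0 < x) :
    2 / (2 * x + 1) ≤ Real.log (x + 1) - Real.log x := by
  have hx1 : 0 < x + 1 := by linarith
  have h := Real.le_log_one_add_of_nonneg (inv_pos.2 hx).le
  rw [← Real.log_div hx1.ne' hx.ne']
  convert h using 1
  · field_simp
    ring
  · congr 1
    field_simp

/-- A function on `(0, ∞)` that tends to `0` and does not decrease under `x ↦ x + 1`
is nonpositive. -/
lemma nonpos_of_le_add_one_of_tendsto_zero {g : ℝ → ℝ} (hg : ∀ x, 0 < x → g x ≤ g (x + 1))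
    (hlim : Tendsto g atTop (𝓝 0)) {x : ℝ} (hx : 0 < x) : g x ≤ 0 := by
  have hn : ∀ n : ℕ, g x ≤ g (x + n) := by
    intro n
    induction n with
    | zero => simp
    | succ n ih =>
      refine ih.trans ((hg (x + n) (by positivity)).trans (le_of_eq ?_))
      push_cast
      ring_nf
  have ht : Tendsto (fun n : ℕ => g (x + n)) atTop (𝓝 0) :=
    hlim.comp (tendsto_atTop_add_const_left _ x tendsto_natCast_atTop_atTop)
  exact ge_of_tendsto' ht hn

lemma tendsto_realDigamma_sub_log :
    Tendsto (fun x => realDigamma x - Real.log x + x⁻¹ / 2) atTop (𝓝 0) := by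
  have h0 : Tendsto (fun x : ℝ => x⁻¹ / 2) atTop (𝓝 0) := by
    simpa using tendsto_inv_atTop_zero.div_const (2 : ℝ)
  refine tendsto_of_tendsto_of_tendsto_of_le_of_le' (by simpa using h0.neg) h0 ?_ ?_
  · filter_upwards [eventually_gt_atTop 0] with x hx
    have := log_le_realDigamma_add_inv hx
    linarith
  · filter_upwards [eventually_gt_atTop 0] with x hx
    have := realDigamma_le_log hx
    linarith

/-- The increment under `x ↦ x + 1` is the trapezoidal error for `∫ 1/t` over `[x, x + 1]`, which is
nonnegative. -/
lemma realDigamma_sub_log_add_nonpos {x : ℝ} (hx : 0 < x) :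
    realDigamma x - Real.log x + x⁻¹ / 2 ≤ 0 := by
  refine nonpos_of_le_add_one_of_tendsto_zero
    (g := fun x => realDigamma x - Real.log x + x⁻¹ / 2) (fun y hy => ?_)
    tendsto_realDigamma_sub_log hx
  have := log_add_one_sub_log_le hy
  rw [realDigamma_add_one hy]
  linarith

/-- The same increment is at most that of `-1/x²`. Any bound `O(1/x²)` would serve, so the constant
need not be sharp. -/
lemma neg_inv_sq_le_realDigamma_sub_log_add {x : ℝ} (hx : 0 < x) :
    -(x⁻¹ ^ 2) ≤ realDigamma x - Real.log x + x⁻¹ / 2 := by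
  have hlim : Tendsto (fun x => -(realDigamma x - Real.log x + x⁻¹ / 2) - x⁻¹ ^ 2) atTop (𝓝 0) := by
    simpa using tendsto_realDigamma_sub_log.neg.sub
      ((tendsto_inv_atTop_zero (𝕜 := ℝ)).pow 2)
  have h := nonpos_of_le_add_one_of_tendsto_zero (fun y hy => ?_) hlim hx
  · linarith
  have h1 := le_log_add_one_sub_log hy
  have h2 : (y⁻¹ + (y + 1)⁻¹) / 2 - 2 / (2 * y + 1) ≤ y⁻¹ ^ 2 - (y + 1)⁻¹ ^ 2 := by
    have e1 : (y⁻¹ + (y + 1)⁻¹) / 2 - 2 / (2 * y + 1) = 1 / (2 * y * (y + 1) * (2 * y + 1)) := by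
      field_simp
      ring
    have e2 : y⁻¹ ^ 2 - (y + 1)⁻¹ ^ 2 = (2 * y + 1) / (y ^ 2 * (y + 1) ^ 2) := by
      field_simp
      ring
    rw [e1, e2, div_le_div_iff₀ (by positivity) (by positivity)]
    -- Exactly the difference of the two sides after cross-multiplication.
    have : 0 ≤ y * (y + 1) * (7 * y ^ 2 + 7 * y + 2) := by positivity
    nlinarith
  rw [realDigamma_add_one hy]
  linarith

/-- `ψ(Cx + c) = log x + log C + (c - 1/2) / (C x) + o(1/x)` as `x → ∞`. -/
lemma tendsto_mul_realDigamma_sub_log {C c : ℝ} (hC : 0 < C) (hc : 0 ≤ c) :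
    Tendsto (fun x => x * (realDigamma (C * x + c) - Real.log x - Real.log C)) atTop
      (𝓝 ((c - 1 / 2) / C)) := by
  have hinv : Tendsto (fun x : ℝ => (C * x + c)⁻¹) atTop (𝓝 0) :=
    tendsto_inv_atTop_zero.comp
      (tendsto_atTop_add_const_right _ c (tendsto_id.const_mul_atTop hC))
  have hxinv : Tendsto (fun x : ℝ => x * (C * x + c)⁻¹) atTop (𝓝 C⁻¹) := by
    have : Tendsto (fun x : ℝ => C⁻¹ - C⁻¹ * c * (C * x + c)⁻¹) atTop (𝓝 C⁻¹) := by
      simpa using (hinv.const_mul (C⁻¹ * c)).const_sub C⁻¹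
    refine this.congr' ?_
    filter_upwards [eventually_gt_atTop 0] with x hx
    have : 0 < C * x + c := by positivity
    field_simp
    ring
  have hlog : Tendsto (fun x : ℝ => x * Real.log (1 + c / C / x)) atTop (𝓝 (c / C)) :=
    Real.tendsto_mul_log_one_add_div_atTop (c / C)
  have hrem : Tendsto (fun x : ℝ => x * (realDigamma (C * x + c) - Real.log (C * x + c)
      + (C * x + c)⁻¹ / 2)) atTop (𝓝 0) := by
    have hlow : Tendsto (fun x : ℝ => -(x * (C * x + c)⁻¹ * (C * x + c)⁻¹)) atTop (𝓝 0) := by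
      simpa using (hxinv.mul hinv).neg
    refine tendsto_of_tendsto_of_tendsto_of_le_of_le' hlow tendsto_const_nhds ?_ ?_
    · filter_upwards [eventually_gt_atTop 0] with x hx
      have h0 : 0 < C * x + c := by positivity
      have := mul_le_mul_of_nonneg_left (neg_inv_sq_le_realDigamma_sub_log_add h0) hx.le
      refine le_trans (le_of_eq ?_) this
      ring
    · filter_upwards [eventually_gt_atTop 0] with x hx
      have h0 : 0 < C * x + c := by positivity
      exact mul_nonpos_of_nonneg_of_nonpos hx.le (realDigamma_sub_log_add_nonpos h0)
  have := (hrem.add hlog).sub (hxinv.div_const 2)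
  have e : 0 + c / C - C⁻¹ / 2 = (c - 1 / 2) / C := by
    field_simp
    ring
  rw [e] at this
  refine this.congr' ?_
  filter_upwards [eventually_gt_atTop 0] with x hx
  have h0 : 0 < C * x + c := by positivity
  have h1 : 1 + c / C / x = (C * x + c) / (C * x) := by field_simp
  rw [h1, Real.log_div h0.ne' (by positivity), Real.log_mul hC.ne' hx.ne']
  ring

/-! ### Monotone functions with a logarithmic expansion -/

/-- A nonnegative nonincreasing function with the expansion `S log x + K + c / x + o(1/x)` at `∞`
has `S = 0`, `K ≥ 0` and `c ≥ 0`. -/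
lemma expansion_coeffs_of_antitoneOn {f : ℝ → ℝ} {S K c : ℝ}
    (hf0 : ∀ x, 0 < x → 0 ≤ f x) (hf : AntitoneOn f (Ioi 0))
    (hc : Tendsto (fun x => x * (f x - S * Real.log x - K)) atTop (𝓝 c)) :
    S = 0 ∧ 0 ≤ K ∧ 0 ≤ c := by
  have he : Tendsto (fun x => f x - S * Real.log x - K) atTop (𝓝 0) := by
    have := hc.mul tendsto_inv_atTop_zero
    rw [mul_zero] at this
    refine this.congr' ?_
    filter_upwards [eventually_gt_atTop 0] with x hx
    field_simp
  have hloginv : Tendsto (fun x => (Real.log x)⁻¹) atTop (𝓝 0) :=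
    tendsto_inv_atTop_zero.comp Real.tendsto_log_atTop
  -- Here `f ≤ f 1` beyond `1`, so `f / log → 0`, whereas the expansion gives the limit `S`.
  have hdiv : Tendsto (fun x => f x * (Real.log x)⁻¹) atTop (𝓝 0) := by
    refine tendsto_of_tendsto_of_tendsto_of_le_of_le' tendsto_const_nhds
      (by simpa using hloginv.const_mul (f 1)) ?_ ?_
    · filter_upwards [eventually_gt_atTop 1] with x hx
      have := Real.log_pos hx
      have := hf0 x (by linarith)
      positivity
    · filter_upwards [eventually_gt_atTop 1] with x hx
      have := Real.log_pos hx
      exact mul_le_mul_of_nonneg_right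
        (hf (mem_Ioi.2 one_pos) (mem_Ioi.2 (by linarith)) hx.le) (by positivity)
  have hS : S = 0 := by
    have h1 := (hdiv.sub (he.mul hloginv)).sub (hloginv.const_mul K)
    have h2 : Tendsto (fun _ : ℝ => S) atTop (𝓝 (0 - 0 * 0 - K * 0)) := by
      refine h1.congr' ?_
      filter_upwards [eventually_gt_atTop 1] with x hx
      have := (Real.log_pos hx).ne'
      field_simp
      ring
    simpa using tendsto_nhds_unique tendsto_const_nhds h2
  subst hS
  have hfK : Tendsto f atTop (𝓝 K) := by
    have := he.add_const K
    simpa using this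
  have hKf : ∀ x, 0 < x → K ≤ f x := fun x hx =>
    le_of_tendsto hfK (by
      filter_upwards [eventually_ge_atTop x] with y hy
      exact hf hx (lt_of_lt_of_le hx hy) hy)
  refine ⟨rfl, ge_of_tendsto hfK ?_, ge_of_tendsto hc ?_⟩
  · filter_upwards [eventually_gt_atTop 0] with x hx using hf0 x hx
  · filter_upwards [eventually_gt_atTop 0] with x hx
    have := hKf x hx
    exact mul_nonneg hx.le (by linarith)

/-! ### Completely monotonic functions and holomorphic extension -/

lemma IsCompletelyMonotonic.antitoneOn {f : ℝ → ℝ} (hf : IsCompletelyMonotonic f) :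
    AntitoneOn f (Ioi 0) := by
  refine antitoneOn_of_deriv_nonpos (convex_Ioi 0) hf.1.continuousOn ?_ fun x hx => ?_
  · rw [interior_Ioi]
    exact hf.1.differentiableOn (by simp)
  · rw [interior_Ioi] at hx
    have := hf.2 1 x hx
    rw [iteratedDeriv_one] at this
    linarith

lemma IsCompletelyMonotonic.nonneg {f : ℝ → ℝ} (hf : IsCompletelyMonotonic f) {x : ℝ}
    (hx : 0 < x) : 0 ≤ f x := by
  simpa using hf.2 0 x hx

lemma iteratedDeriv_ofReal_of_analyticAt {s : Set ℝ} (hs : IsOpen s) {F : ℂ → ℂ} {f : ℝ → ℝ}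
    (hF : ∀ x ∈ s, AnalyticAt ℂ F x) (hFf : ∀ x ∈ s, F x = f x) (n : ℕ) :
    ∀ x ∈ s, iteratedDeriv n F x = (iteratedDeriv n f x : ℝ) := by
  induction n generalizing F f with
  | zero => simpa using hFf
  | succ n ih =>
    simp only [iteratedDeriv_succ']
    refine ih (fun x hx => (hF x hx).deriv) fun x hx => ?_
    have hd := (hF x hx).differentiableAt.hasDerivAt
    have hev : (fun y : ℝ => F y) =ᶠ[𝓝 x] fun y => (f y : ℂ) := by
      filter_upwards [hs.mem_nhds hx] with y hy using hFf y hy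
    have hf : HasDerivAt f (deriv F x).re x := by
      refine hd.real_of_complex.congr_of_eventuallyEq ?_
      filter_upwards [hs.mem_nhds hx] with y hy
      rw [hFf y hy, Complex.ofReal_re]
    rw [hf.deriv]
    exact (hd.comp_ofReal.congr_of_eventuallyEq hev.symm).unique hf.ofReal_comp

open scoped ComplexOrder in
/-- If a completely monotonic function extends holomorphically to the half-plane `re z > -r`, then
the extension is nonnegative on `(-r, ∞)`. -/
lemma IsCompletelyMonotonic.nonneg_of_holomorphic_extension {f g : ℝ → ℝ}
    (hf : IsCompletelyMonotonic f) (hfg : ∀ x, 0 < x → f x = g x) {r : ℝ} (hr : 0 ≤ r) {F : ℂ → ℂ}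
    (hF : DifferentiableOn ℂ F {z | -r < z.re}) (hFg : ∀ x : ℝ, -r < x → F x = g x) {x : ℝ}
    (hx : -r < x) : 0 ≤ g x := by
  obtain ⟨c, hc0, hxc⟩ : ∃ c : ℝ, 0 < c ∧ x ≤ c := ⟨max x 1, by positivity, le_max_left _ _⟩
  have hopen : IsOpen {z : ℂ | -r < z.re} := isOpen_lt continuous_const Complex.continuous_re
  have hder : ∀ n : ℕ, iteratedDeriv n F c = (iteratedDeriv n f c : ℝ) := by
    refine fun n => iteratedDeriv_ofReal_of_analyticAt isOpen_Ioi (fun y hy => ?_) (fun y hy => ?_)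
      n c (mem_Ioi.2 hc0)
    · have hy : 0 < y := hy
      refine hF.analyticAt (hopen.mem_nhds ?_)
      simp only [mem_ofPred_eq, Complex.ofReal_re]
      linarith
    · have hy : 0 < y := hy
      rw [hFg y (by linarith), hfg y hy]
  -- Reflection makes all derivatives at the centre `-c` nonnegative. The disc of radius `c + r`
  -- lies in `re z < r`, and `x ≤ c` puts `-x` to the right of the centre.
  have key := DifferentiableOn.nonneg_of_iteratedDeriv_nonneg
    (f := fun z => F (-z)) (c := -(c : ℂ)) (r := c + r) ?_ ?_ (z := -(x : ℂ)) ?_ ?_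
  · rw [neg_neg, hFg x hx] at key
    exact_mod_cast key
  · refine hF.comp differentiable_neg.differentiableOn fun z hz => ?_
    rw [Metric.mem_ball, Complex.dist_eq, sub_neg_eq_add] at hz
    have := (Complex.re_le_norm (z + c)).trans_lt hz
    simp only [Complex.add_re, Complex.ofReal_re] at this
    simp only [mem_ofPred_eq, Complex.neg_re]
    linarith
  · intro n
    rw [iteratedDeriv_comp_neg, neg_neg, hder n, smul_eq_mul]
    exact_mod_cast hf.2 n c hc0
  · exact neg_le_neg (by exact_mod_cast hxc)
  · rw [Metric.mem_ball, Complex.dist_eq, ← Complex.ofReal_neg, ← Complex.ofReal_neg,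
      ← Complex.ofReal_sub, Complex.norm_real, Real.norm_eq_abs, abs_lt]
    constructor <;> linarith

/-! ### Holomorphy of digamma and its pole at zero -/

lemma Complex.ne_neg_natCast_of_re_pos {z : ℂ} (hz : 0 < z.re) (m : ℕ) : z ≠ -m := by
  rintro rfl
  simp only [Complex.neg_re, Complex.natCast_re] at hz
  have : (0 : ℝ) ≤ m := m.cast_nonneg
  linarith

lemma Complex.differentiableAt_digamma {z : ℂ} (hz : 0 < z.re) :
    DifferentiableAt ℂ Complex.digamma z := by
  have hopen : IsOpen {z : ℂ | 0 < z.re} := isOpen_lt continuous_const Complex.continuous_re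
  have hd : DifferentiableOn ℂ Complex.Gamma {z : ℂ | 0 < z.re} := fun w hw =>
    (Complex.differentiableAt_Gamma w
      (Complex.ne_neg_natCast_of_re_pos hw)).differentiableWithinAt
  have ha := hd.analyticAt (hopen.mem_nhds hz)
  exact ha.deriv.differentiableAt.div ha.differentiableAt (Complex.Gamma_ne_zero_of_re_pos hz)

lemma Complex.digamma_ofReal {x : ℝ} (hx : 0 < x) : Complex.digamma x = realDigamma x := by
  have hd := (Complex.differentiableAt_Gamma x
    (Complex.ne_neg_natCast_of_re_pos (by simpa using hx))).hasDerivAt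
  have h := hd.comp_ofReal
  simp only [Complex.Gamma_ofReal] at h
  have hr : HasDerivAt Real.Gamma (deriv Real.Gamma x) x :=
    ((Real.differentiableOn_Gamma_Ioi x hx).differentiableAt (Ioi_mem_nhds hx)).hasDerivAt
  rw [Complex.digamma_def, logDeriv_apply, realDigamma, logDeriv_apply, Complex.Gamma_ofReal,
    h.unique hr.ofReal_comp, Complex.ofReal_div]

lemma continuousAt_realDigamma {x : ℝ} (hx : 0 < x) : ContinuousAt realDigamma x := by
  have h := (Complex.differentiableAt_digamma (z := (x : ℂ)) (by simpa using hx)).hasDerivAt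
  refine h.real_of_complex.continuousAt.congr ?_
  filter_upwards [Ioi_mem_nhds hx] with y hy
  rw [Complex.digamma_ofReal hy, Complex.ofReal_re]

/-- `x ψ(C x + c)` tends to `-1 / C` if `c = 0`, and to `0` if `c > 0`, as `x → 0+`. -/
lemma tendsto_mul_realDigamma_nhdsGT_zero {C c : ℝ} (hC : 0 < C) (hc : 0 ≤ c) :
    Tendsto (fun x => x * realDigamma (C * x + c)) (𝓝[>] 0) (𝓝 (if c = 0 then -C⁻¹ else 0)) := by
  have hid : Tendsto (fun x : ℝ => x) (𝓝[>] 0) (𝓝 0) := nhdsWithin_le_nhds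
  have hlin : ∀ d : ℝ, Tendsto (fun x : ℝ => C * x + d) (𝓝[>] 0) (𝓝 d) := fun d => by
    simpa using (hid.const_mul C).add_const d
  split_ifs with h
  · subst h
    -- The recurrence splits off the pole: `ψ(Cx) = ψ(Cx + 1) - 1/(Cx)`.
    have h1 : Tendsto (fun x : ℝ => x * realDigamma (C * x + 1) - C⁻¹) (𝓝[>] 0) (𝓝 (-C⁻¹)) := by
      simpa using (hid.mul ((continuousAt_realDigamma one_pos).tendsto.comp (hlin 1))).sub_const C⁻¹
    refine h1.congr' ?_
    filter_upwards [self_mem_nhdsWithin] with x hx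
    have hx : 0 < x := hx
    rw [realDigamma_add_one (by positivity), add_zero]
    field_simp
    ring
  · have hc' : 0 < c := lt_of_le_of_ne hc (Ne.symm h)
    simpa using hid.mul ((continuousAt_realDigamma hc').tendsto.comp (hlin c))

/-! ### The logarithmic derivative of the Gamma ratio -/

/-- `-(log V)'`, written with the digamma function. -/
noncomputable def gammaRatioNegLogDeriv {p s : ℕ} (θ : ℝ) (A a α : Fin p → ℝ) (B b β : Fin s → ℝ) (x : ℝ) : ℝ :=
  Real.log θ - ∑ i, α i * A i * realDigamma (A i * x + a i) +
    ∑ j, β j * B j * realDigamma (B j * x + b j)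

section

variable {p s : ℕ} {θ : ℝ} {A a α : Fin p → ℝ} {B b β : Fin s → ℝ}

lemma log_gammaRatio (hθ : 0 < θ)
    (hA : ∀ i, 0 < A i) (ha : ∀ i, 0 ≤ a i) (hB : ∀ j, 0 < B j) (hb : ∀ j, 0 ≤ b j)
    {x : ℝ} (hx : 0 < x) :
    Real.log (gammaRatio θ A a α B b β x) =
      -x * Real.log θ + (∑ i, α i * Real.log (Real.Gamma (A i * x + a i)) -
        ∑ j, β j * Real.log (Real.Gamma (B j * x + b j))) := by
  have h1 : ∀ i, 0 < Real.Gamma (A i * x + a i) := fun i =>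
    Real.Gamma_pos_of_pos (add_pos_of_pos_of_nonneg (mul_pos (hA i) hx) (ha i))
  have h2 : ∀ j, 0 < Real.Gamma (B j * x + b j) := fun j =>
    Real.Gamma_pos_of_pos (add_pos_of_pos_of_nonneg (mul_pos (hB j) hx) (hb j))
  have h3 : ∀ i, 0 < Real.Gamma (A i * x + a i) ^ α i := fun i => Real.rpow_pos_of_pos (h1 i) _
  have h4 : ∀ j, 0 < Real.Gamma (B j * x + b j) ^ β j := fun j => Real.rpow_pos_of_pos (h2 j) _
  have h5 := Finset.prod_pos (s := Finset.univ) fun i _ => h3 i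
  have h6 := Finset.prod_pos (s := Finset.univ) fun j _ => h4 j
  rw [gammaRatio, Real.log_mul (Real.rpow_pos_of_pos hθ _).ne' (div_pos h5 h6).ne',
    Real.log_div h5.ne' h6.ne', Real.log_rpow hθ, Real.log_prod fun i _ => (h3 i).ne',
    Real.log_prod fun j _ => (h4 j).ne']
  simp only [Real.log_rpow (h1 _), Real.log_rpow (h2 _)]

lemma neg_deriv_log_gammaRatio (hθ : 0 < θ)
    (hA : ∀ i, 0 < A i) (ha : ∀ i, 0 ≤ a i) (hB : ∀ j, 0 < B j) (hb : ∀ j, 0 ≤ b j)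
    {x : ℝ} (hx : 0 < x) :
    -deriv (fun y => Real.log (gammaRatio θ A a α B b β y)) x =
      gammaRatioNegLogDeriv θ A a α B b β x := by
  have hG : ∀ C c d : ℝ, 0 < C → 0 ≤ c →
      HasDerivAt (fun y => d * Real.log (Real.Gamma (C * y + c)))
        (d * (realDigamma (C * x + c) * C)) x := fun C c d hC hc =>
    (HasDerivAt.comp (h := fun y => C * y + c) x
      (hasDerivAt_log_Gamma (by positivity : 0 < C * x + c))
      (by simpa using ((hasDerivAt_id x).const_mul C).add_const c)).const_mul d
  have h := (((hasDerivAt_id x).neg.mul_const (Real.log θ)).add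
    ((HasDerivAt.fun_sum fun i (_ : i ∈ Finset.univ) => hG (A i) (a i) (α i) (hA i) (ha i)).sub
      (HasDerivAt.fun_sum fun j (_ : j ∈ Finset.univ) => hG (B j) (b j) (β j) (hB j) (hb j))))
  have h' := h.congr_of_eventuallyEq
    (f₁ := fun y => Real.log (gammaRatio θ A a α B b β y)) (by
      filter_upwards [Ioi_mem_nhds hx] with y hy using log_gammaRatio hθ hA ha hB hb hy)
  rw [h'.deriv, gammaRatioNegLogDeriv]
  simp only [mul_assoc, mul_comm (realDigamma _)]
  ring

lemma log_gammaRatioRho (hA : ∀ i, 0 < A i) (hB : ∀ j, 0 < B j) :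
    Real.log (gammaRatioRho A α B β) =
      ∑ i, α i * A i * Real.log (A i) - ∑ j, β j * B j * Real.log (B j) := by
  have h3 : ∀ i, 0 < A i ^ (α i * A i) := fun i => Real.rpow_pos_of_pos (hA i) _
  have h4 : ∀ j, 0 < B j ^ (-(β j * B j)) := fun j => Real.rpow_pos_of_pos (hB j) _
  rw [gammaRatioRho, Real.log_mul (Finset.prod_pos fun i _ => h3 i).ne'
    (Finset.prod_pos fun j _ => h4 j).ne', Real.log_prod fun i _ => (h3 i).ne',
    Real.log_prod fun j _ => (h4 j).ne']
  simp only [Real.log_rpow (hA _), Real.log_rpow (hB _), neg_mul, Finset.sum_neg_distrib]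
  ring

lemma gammaRatioRho_pos (hA : ∀ i, 0 < A i) (hB : ∀ j, 0 < B j) : 0 < gammaRatioRho A α B β :=
  mul_pos (Finset.prod_pos fun i _ => Real.rpow_pos_of_pos (hA i) _)
    (Finset.prod_pos fun j _ => Real.rpow_pos_of_pos (hB j) _)

lemma tendsto_mul_gammaRatioNegLogDeriv_atTop
    (hA : ∀ i, 0 < A i) (ha : ∀ i, 0 ≤ a i) (hB : ∀ j, 0 < B j) (hb : ∀ j, 0 ≤ b j) :
    Tendsto (fun x => x * (gammaRatioNegLogDeriv θ A a α B b β x -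
        (∑ j, β j * B j - ∑ i, α i * A i) * Real.log x -
        (Real.log θ - Real.log (gammaRatioRho A α B β)))) atTop
      (𝓝 (∑ j, β j * (b j - 1 / 2) - ∑ i, α i * (a i - 1 / 2))) := by
  have hsum : ∀ {n : ℕ} {C c d : Fin n → ℝ}, (∀ k, 0 < C k) → (∀ k, 0 ≤ c k) →
      Tendsto (fun x => ∑ k, d k * C k *
        (x * (realDigamma (C k * x + c k) - Real.log x - Real.log (C k)))) atTop
        (𝓝 (∑ k, d k * (c k - 1 / 2))) := by
    intro n C c d hC hc
    refine tendsto_finsetSum _ fun k _ => ?_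
    have h := (tendsto_mul_realDigamma_sub_log (hC k) (hc k)).const_mul (d k * C k)
    convert h using 2
    have := (hC k).ne'
    field_simp
  refine ((hsum (d := β) hB hb).sub (hsum (d := α) hA ha)).congr fun x => ?_
  have e : ∀ {n : ℕ} {C c d : Fin n → ℝ}, ∑ k, d k * C k *
      (x * (realDigamma (C k * x + c k) - Real.log x - Real.log (C k))) =
      x * (∑ k, d k * C k * realDigamma (C k * x + c k) - (∑ k, d k * C k) * Real.log x -
        ∑ k, d k * C k * Real.log (C k)) := by
    intro n C c d
    rw [Finset.sum_mul, ← Finset.sum_sub_distrib, ← Finset.sum_sub_distrib, Finset.mul_sum]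
    exact Finset.sum_congr rfl fun k _ => by ring
  rw [e, e, log_gammaRatioRho hA hB, gammaRatioNegLogDeriv]
  ring

/-- The limit is the residue at `-r`. Only terms with `c / C = r` have a pole there; it is `-1/(C
x)`, and the weight `d * C` cancels the `C`. -/
lemma tendsto_mul_gammaRatioNegLogDeriv_nhdsGT {r : ℝ} (hA : ∀ i, 0 < A i) (hB : ∀ j, 0 < B j)
    (hra : ∀ i, r ≤ a i / A i) (hrb : ∀ j, r ≤ b j / B j) :
    Tendsto (fun x => x * gammaRatioNegLogDeriv θ A a α B b β (x - r)) (𝓝[>] 0)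
      (𝓝 (∑ i with a i / A i = r, α i - ∑ j with b j / B j = r, β j)) := by
  have hsum : ∀ {n : ℕ} {C c d : Fin n → ℝ}, (∀ k, 0 < C k) → (∀ k, r ≤ c k / C k) →
      Tendsto (fun x => ∑ k, d k * C k * (x * realDigamma (C k * (x - r) + c k))) (𝓝[>] 0)
        (𝓝 (-∑ k with c k / C k = r, d k)) := by
    intro n C c d hC hc
    rw [Finset.sum_filter, ← Finset.sum_neg_distrib]
    refine tendsto_finsetSum _ fun k _ => ?_
    have hck : 0 ≤ c k - C k * r := by
      have := (le_div_iff₀ (hC k)).1 (hc k)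
      linarith
    have h := (tendsto_mul_realDigamma_nhdsGT_zero (hC k) hck).const_mul (d k * C k)
    have hCk := (hC k).ne'
    have hiff : c k - C k * r = 0 ↔ c k / C k = r := by
      rw [div_eq_iff hCk, sub_eq_zero, mul_comm]
    convert h using 2
    · congr 3
      ring
    · by_cases h0 : c k / C k = r
      · rw [if_pos h0, if_pos (hiff.2 h0)]
        field_simp
      · rw [if_neg h0, if_neg (fun h1 => h0 (hiff.1 h1))]
        simp
  have hid : Tendsto (fun x : ℝ => x) (𝓝[>] 0) (𝓝 0) := nhdsWithin_le_nhds
  have h := ((hid.mul_const (Real.log θ)).sub (hsum (d := α) hA hra)).add (hsum (d := β) hB hrb)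
  convert h using 2
  · rw [gammaRatioNegLogDeriv, mul_add, mul_sub, Finset.mul_sum, Finset.mul_sum]
    congr 1
    · congr 1
      exact Finset.sum_congr rfl fun k _ => by ring
    · exact Finset.sum_congr rfl fun k _ => by ring
  · ring

/-- For `re z > -r` every argument `C z + c` has positive real part, so replacing `ψ` by the complex
digamma function gives the required extension. -/
lemma gammaRatioNegLogDeriv_nonneg {r : ℝ} (hθ : 0 < θ) (hr : 0 ≤ r)
    (hA : ∀ i, 0 < A i) (ha : ∀ i, 0 ≤ a i) (hB : ∀ j, 0 < B j) (hb : ∀ j, 0 ≤ b j)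
    (hra : ∀ i, r ≤ a i / A i) (hrb : ∀ j, r ≤ b j / B j)
    (hV : IsLogCompletelyMonotonic (gammaRatio θ A a α B b β)) {x : ℝ} (hx : -r < x) :
    0 ≤ gammaRatioNegLogDeriv θ A a α B b β x := by
  have hpos : ∀ {C c y : ℝ}, 0 < C → r ≤ c / C → -r < y → 0 < C * y + c := by
    intro C c y hC hc hy
    have h1 := (le_div_iff₀ hC).1 hc
    have h2 := mul_lt_mul_of_pos_left hy hC
    linarith
  refine hV.2.2.nonneg_of_holomorphic_extension
    (fun y hy => neg_deriv_log_gammaRatio hθ hA ha hB hb hy) hr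
    (F := fun z => Real.log θ - ∑ i, α i * A i * Complex.digamma (A i * z + a i) +
      ∑ j, β j * B j * Complex.digamma (B j * z + b j)) ?_ ?_ hx
  · have hd : ∀ {C c d : ℝ}, 0 < C → r ≤ c / C → DifferentiableOn ℂ
        (fun z => d * C * Complex.digamma (C * z + c)) {z | -r < z.re} := by
      intro C c d hC hc z hz
      refine DifferentiableAt.differentiableWithinAt (DifferentiableAt.const_mul ?_ _)
      refine DifferentiableAt.comp z (Complex.differentiableAt_digamma ?_) (by fun_prop)
      simpa using hpos hC hc hz
    exact ((differentiableOn_const _).sub (DifferentiableOn.fun_sum fun i _ =>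
      hd (hA i) (hra i))).add (DifferentiableOn.fun_sum fun j _ => hd (hB j) (hrb j))
  · intro y hy
    have hcast : ∀ {C c : ℝ}, 0 < C → r ≤ c / C →
        Complex.digamma (C * y + c) = realDigamma (C * y + c) := by
      intro C c hC hc
      rw [← Complex.digamma_ofReal (hpos hC hc hy)]
      push_cast
      rfl
    simp only [hcast (hA _) (hra _), hcast (hB _) (hrb _), gammaRatioNegLogDeriv]
    push_cast
    rfl

/-- The residue of `-(log V)'` at its first possible singularity is nonnegative. -/
lemma sum_le_sum_of_isLogCompletelyMonotonic {r : ℝ} (hθ : 0 < θ) (hr : 0 ≤ r)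
    (hA : ∀ i, 0 < A i) (ha : ∀ i, 0 ≤ a i) (hB : ∀ j, 0 < B j) (hb : ∀ j, 0 ≤ b j)
    (hra : ∀ i, r ≤ a i / A i) (hrb : ∀ j, r ≤ b j / B j)
    (hV : IsLogCompletelyMonotonic (gammaRatio θ A a α B b β)) :
    ∑ j with b j / B j = r, β j ≤ ∑ i with a i / A i = r, α i := by
  rw [← sub_nonneg]
  refine ge_of_tendsto (tendsto_mul_gammaRatioNegLogDeriv_nhdsGT (θ := θ) hA hB hra hrb) ?_
  filter_upwards [self_mem_nhdsWithin] with x hx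
  have hx : 0 < x := hx
  exact mul_nonneg hx.le
    (gammaRatioNegLogDeriv_nonneg hθ hr hA ha hB hb hra hrb hV (by linarith))

lemma minQuotient_le [NeZero p] (A a : Fin p → ℝ) (i : Fin p) : minQuotient A a ≤ a i / A i :=
  Finset.inf'_le _ (Finset.mem_univ i)

lemma exists_eq_minQuotient [NeZero p] (A a : Fin p → ℝ) : ∃ i, a i / A i = minQuotient A a := by
  obtain ⟨i, -, hi⟩ := Finset.exists_mem_eq_inf' (Finset.univ_nonempty (α := Fin p))
    (fun k => a k / A k)
  exact ⟨i, hi.symm⟩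

lemma minQuotient_nonneg [NeZero p] (hA : ∀ i, 0 < A i) (ha : ∀ i, 0 ≤ a i) :
    0 ≤ minQuotient A a := by
  obtain ⟨i, hi⟩ := exists_eq_minQuotient A a
  exact hi ▸ div_nonneg (ha i) (hA i).le

end

theorem mainTheorem11 {p s : ℕ} [NeZero p] [NeZero s]
    (θ : ℝ) (A a α : Fin p → ℝ) (B b β : Fin s → ℝ)
    (hθ : 0 < θ)
    (hA : ∀ i, 0 < A i) (hα : ∀ i, 0 < α i) (ha : ∀ i, 0 ≤ a i)
    (hB : ∀ j, 0 < B j) (hβ : ∀ j, 0 < β j) (hb : ∀ j, 0 ≤ b j)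
    (hV : IsLogCompletelyMonotonic (gammaRatio θ A a α B b β)) :
    (∑ i, α i * A i = ∑ j, β j * B j ∧ gammaRatioRho A α B β ≤ θ) ∧
    0 ≤ ∑ j, β j * (b j - 1 / 2) - ∑ i, α i * (a i - 1 / 2) ∧
    minQuotient A a ≤ minQuotient B b ∧
    (minQuotient A a = minQuotient B b →
      ∑ m ∈ minIndices B b, β m ≤ ∑ k ∈ minIndices A a, α k) := by
  have heq : ∀ x, 0 < x → -deriv (fun y => Real.log (gammaRatio θ A a α B b β y)) x =
      gammaRatioNegLogDeriv θ A a α B b β x :=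
    fun x hx => neg_deriv_log_gammaRatio hθ hA ha hB hb hx
  obtain ⟨hS, hK, hc⟩ := expansion_coeffs_of_antitoneOn
    (fun x hx => heq x hx ▸ hV.2.2.nonneg hx) (hV.2.2.antitoneOn.congr fun x hx => heq x hx)
    (tendsto_mul_gammaRatioNegLogDeriv_atTop (θ := θ) (α := α) (β := β) hA ha hB hb)
  refine ⟨⟨by linarith, (Real.log_le_log_iff (gammaRatioRho_pos hA hB) hθ).1 (by linarith)⟩, hc,
    ?_, fun h => ?_⟩
  · by_contra! hlt
    have hra : ∀ i, minQuotient B b < a i / A i := fun i => hlt.trans_le (minQuotient_le A a i)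
    -- At `r = min b / B` the strict inequality leaves no `α` in the residue, while at least one
    -- positive `β` remains.
    have hle := sum_le_sum_of_isLogCompletelyMonotonic hθ (minQuotient_nonneg hB hb) hA ha hB hb
      (fun i => (hra i).le) (minQuotient_le B b) hV
    rw [Finset.filter_false_of_mem fun i _ => (hra i).ne', Finset.sum_empty] at hle
    obtain ⟨j, hj⟩ := exists_eq_minQuotient B b
    exact hle.not_gt (Finset.sum_pos (fun k _ => hβ k) ⟨j, by simpa using hj⟩)
  · have hle := sum_le_sum_of_isLogCompletelyMonotonic hθ (minQuotient_nonneg hA ha) hA ha hB hb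
      (minQuotient_le A a) (fun j => h ▸ minQuotient_le B b j) hV
    rw [minIndices, minIndices, ← h]
    exact hle
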